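/- Let $T=(I,E)$ be a finite tree in which every edge has unit resistance, and let $S^0\subseteq I$ be a set of leaves (nodes of degree $1$) with $|S^0|\ge 2$. For $\ell\in I\setminus S^0$ let $W^{(\ell)}:I\to\mathbb{R}$ be the voltage that is $0$ on $S^0$ and $1$ at $\ell$, that is, the unique function with $W^{(\ell)}(s)=0$ for $s\in S^0$, $W^{(\ell)}(\ell)=1$ and $\sum_{j:\{i,j\}\in E}\bigl(W^{(\ell)}(i)-W^{(\ell)}(j)\bigr)=0$ for every $i\notin S^0\cup\{\ell\}$. Define the Harmonic Influence Centrality of $\ell\in I\setminus S^0$ by $$H(\ell)=\sum_{i\in I,\ i\neq \ell}W^{(\ell)}(i).$$ Let $K$ be the set of nodes $i\in I$ for which there are $s',s''\in S^0$ such that $i$ belongs to a simple path between $s'$ and $s''$, and let $K'$ be the set of nodes of $K$ that have degree at least $3$ in $T$. Then $$\operatorname*{argmax}_{\ell\in I\setminus S^0}H(\ell)=\operatorname*{argmax}_{\ell\in K\setminus S^0}H(\ell),$$ and, if $K'\neq\emptyset$, $$\operatorname*{argmax}_{\ell\in I\setminus S^0}H(\ell)=\operatorname*{argmax}_{\ell\in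 K'}H(\ell),$$ where $\operatorname{argmax}$ denotes the set of all maximizers. -/

import Mathlib

namespace OSAP

/-- `W` is a voltage on the graph `G` with unit resistances on all edges, equal to `0` on `S0` and
to `1` at `l`: by Ohm's and Kirchhoff's laws the input current at a node `i` is
`(lapMatrix *ᵥ W) i = ∑ j ∈ N_i, (W i - W j)`, and it vanishes off `S0 ∪ {l}`. -/
def IsVoltage {I : Type*} [Fintype I] [DecidableEq I] (G : SimpleGraph I) [DecidableRel G.Adj]
    (S0 : Finset I) (l : I) (W : I → ℝ) : Prop :=
  (∀ s ∈ S0, W s = 0) ∧ W l = 1 ∧ ∀ i, i ∉ S0 → i ≠ l → ((G.lapMatrix ℝ).mulVec W) i = 0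

/-- On a connected graph the voltage exists and is unique. -/
theorem existsUnique_isVoltage {I : Type*} [Fintype I] [DecidableEq I] {G : SimpleGraph I}
    [DecidableRel G.Adj] (hG : G.Connected) {S0 : Finset I} {l : I} (hl : l ∉ S0) :
    ∃! W : I → ℝ, IsVoltage G S0 l W := by
  classical
  let A : (I → ℝ) →ₗ[ℝ] (I → ℝ) :=
    { toFun := fun W i => if i ∈ S0 ∨ i = l then W i else ((G.lapMatrix ℝ).mulVec W) i
      map_add' := by
        intro x y; ext i
        by_cases h : i ∈ S0 ∨ i = l <;> simp [h, Matrix.mulVec_add]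
      map_smul' := by
        intro c x; ext i
        by_cases h : i ∈ S0 ∨ i = l <;> simp [h, Matrix.mulVec_smul] }
  have hA : ∀ W i, A W i = if i ∈ S0 ∨ i = l then W i else ((G.lapMatrix ℝ).mulVec W) i :=
    fun _ _ => rfl
  have hinj : Function.Injective A := by
    rw [← LinearMap.ker_eq_bot, LinearMap.ker_eq_bot']
    intro W hW
    have h0 : ∀ i, W i * ((G.lapMatrix ℝ).mulVec W) i = 0 := by
      intro i
      have := congrFun hW i
      rw [hA] at this
      by_cases h : i ∈ S0 ∨ i = l
      · rw [if_pos h] at this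
        simp [this]
      · rw [if_neg h] at this
        simp [this]
    have h1 : Matrix.toLinearMap₂' ℝ (G.lapMatrix ℝ) W W = 0 := by
      rw [Matrix.toLinearMap₂'_apply']
      exact Finset.sum_eq_zero fun i _ => h0 i
    rw [SimpleGraph.lapMatrix_toLinearMap₂'_apply'_eq_zero_iff_forall_reachable] at h1
    ext i
    have h2 := congrFun hW l
    rw [hA, if_pos (Or.inr rfl)] at h2
    rw [h1 i l (hG.preconnected i l), h2, Pi.zero_apply, Pi.zero_apply]
  have key : ∀ W, IsVoltage G S0 l W ↔ A W = fun i => if i = l then 1 else 0 := by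
    intro W
    constructor
    · rintro ⟨h1, h2, h3⟩
      ext i
      rw [hA]
      by_cases hi : i = l
      · simp [hi, h2]
      · by_cases hs : i ∈ S0
        · simp [hi, hs, h1 i hs]
        · simp [hi, hs, h3 i hs hi]
    · intro h
      have h' : ∀ i, (if i ∈ S0 ∨ i = l then W i else ((G.lapMatrix ℝ).mulVec W) i)
          = if i = l then 1 else 0 := fun i => congrFun h i
      refine ⟨fun s hs => ?_, ?_, fun i hi hil => ?_⟩
      · have hsl : s ≠ l := fun e => hl (e ▸ hs)
        simpa [hs, hsl] using h' s
      · simpa using h' l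
      · simpa [hi, hil] using h' i
  obtain ⟨W, hW⟩ := (LinearMap.injective_iff_surjective.mp hinj) (fun i => if i = l then 1 else 0)
  exact ⟨W, (key W).2 hW, fun V hV => hinj (((key V).1 hV).trans hW.symm)⟩

open Classical in
/-- The voltage that is `0` on `S0` and `1` at `l`; the fallback value `0` is never used on a
connected graph with `l ∉ S0`. -/
noncomputable def voltage {I : Type*} [Fintype I] [DecidableEq I] (G : SimpleGraph I)
    [DecidableRel G.Adj] (S0 : Finset I) (l : I) : I → ℝ :=
  if h : ∃ W : I → ℝ, IsVoltage G S0 l W then h.choose else 0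

theorem isVoltage_voltage {I : Type*} [Fintype I] [DecidableEq I] {G : SimpleGraph I}
    [DecidableRel G.Adj] (hG : G.Connected) {S0 : Finset I} {l : I} (hl : l ∉ S0) :
    IsVoltage G S0 l (voltage G S0 l) := by
  have h := (existsUnique_isVoltage hG hl).exists
  rw [voltage, dif_pos h]
  exact h.choose_spec

/-- Harmonic Influence Centrality of a node `l ∉ S0`: the sum of the voltages (the asymptotic
opinions) over all nodes other than `l`. -/
noncomputable def hic {I : Type*} [Fintype I] [DecidableEq I] (G : SimpleGraph I)
    [DecidableRel G.Adj] (S0 : Finset I) (l : I) : ℝ :=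
  ∑ i ∈ Finset.univ.erase l, voltage G S0 l i

/-- The nodes that belong to a simple path between two nodes of `S0`. -/
def pathNodes {I : Type*} (G : SimpleGraph I) (S0 : Finset I) : Set I :=
  {i | ∃ s ∈ S0, ∃ t ∈ S0, ∃ p : G.Walk s t, p.IsPath ∧ i ∈ p.support}

/-- The nodes of `pathNodes G S0` that have degree at least three in `G`. -/
def branchNodes {I : Type*} [Fintype I] (G : SimpleGraph I) [DecidableRel G.Adj]
    (S0 : Finset I) : Set I :=
  {i | i ∈ pathNodes G S0 ∧ 3 ≤ G.degree i}

/-- The set of maximizers of `f` over `A`. -/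
def argmaxOn {I : Type*} (f : I → ℝ) (A : Set I) : Set I :=
  {l | l ∈ A ∧ ∀ m ∈ A, f m ≤ f l}

end OSAP

/-! It suffices that every excluded `l` is strictly beaten by some node off `S0`; finiteness then
gives both equalities. Let `W` be the voltage for `l`. Moving the source across a bridge to a
neighbour `a` rescales `W` by one constant on each side (`IsBridgeSide.sum_voltage`), so the new
centrality is explicit in the old voltage.

If `l` is on no path between nodes of `S0`, then `S0` lies in one side of `l`. Beyond the bridge the
voltage sum is unchanged, while the side of `a` is scaled up by 1 / W a.

Otherwise let `l` have degree two, with neighbours a and b; put x = W a, y = W b, and let P, Q be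
the sums of `W` over their sides. The gains at a and b add up to a term in (x, P) plus the same term
in (y, Q), with the signs of 2(1 - x)P - x and 2(1 - y)Q - y (`bridge_identity`). These are
nonnegative: the current c = 1 - x enters the side of a and no level set emits more, so the squared
currents at a node sum to at most 2c². Their sum weighted by `W` is exactly xc, whence xc ≤ 2c²P. A
node of degree at least three makes this strict on its side, so a or b beats `l`. -/

namespace OSAP

set_option linter.unusedSectionVars false

open SimpleGraph Finset

variable {I : Type*} [Fintype I] [DecidableEq I]

/-- The current from `i` to `j` when every edge has unit resistance. -/
def flow (G : SimpleGraph I) [DecidableRel G.Adj] (W : I → ℝ) (i j : I) : ℝ :=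
  if G.Adj i j then W i - W j else 0

/-- The total outgoing current at `i`, counting only the neighbours of smaller voltage. -/
def outflow (G : SimpleGraph I) [DecidableRel G.Adj] (W : I → ℝ) (i : I) : ℝ :=
  ∑ j, max (flow G W i j) 0

/-- `A` is one side of the bridge `a l`, namely the side of `a`. -/
structure IsBridgeSide (G : SimpleGraph I) (A : Finset I) (a l : I) : Prop where
  adj : G.Adj a l
  mem : a ∈ A
  notMem : l ∉ A
  eq_of_adj : ∀ i ∈ A, ∀ j ∉ A, G.Adj i j → i = a ∧ j = l

/-! ### Currents on one side of a bridge -/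

section Flow

variable {G : SimpleGraph I} [DecidableRel G.Adj] {S0 A : Finset I} {a l : I} {W : I → ℝ}

theorem lapMatrix_mulVec_eq_sum_flow (i : I) :
    ((G.lapMatrix ℝ).mulVec W) i = ∑ j, flow G W i j := by
  rw [lapMatrix_mulVec_apply]
  simp only [flow]
  rw [← Finset.sum_filter, Finset.sum_sub_distrib, Finset.sum_const, nsmul_eq_mul]
  rw [← neighborFinset_eq_filter, card_neighborFinset_eq_degree]

theorem flow_symm (i j : I) : flow G W j i = -flow G W i j := by
  simp only [flow, G.adj_comm j i]
  split_ifs <;> ring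

/-- Currents are antisymmetric. Subtracting a symmetric weight is thus free; this is the summation
by parts behind the identities below. -/
theorem sum_symm_mul_flow_eq_zero (A : Finset I) (h : I → I → ℝ) (hh : ∀ i j, h i j = h j i) :
    ∑ i ∈ A, ∑ j ∈ A, h i j * flow G W i j = 0 := by
  have h1 : ∑ i ∈ A, ∑ j ∈ A, h i j * flow G W i j
      = ∑ i ∈ A, ∑ j ∈ A, -(h i j * flow G W i j) := by
    rw [Finset.sum_comm]
    refine sum_congr rfl fun i _ => sum_congr rfl fun j _ => ?_
    rw [flow_symm i j, hh j i]; ring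
  simp only [sum_neg_distrib] at h1
  linarith

/-- A set of vertices of a connected graph that is closed under adjacency is everything. -/
theorem mem_of_adj_closed (hG : G.Connected) (Y : Set I) (hY : ∀ i ∈ Y, ∀ j, G.Adj i j → j ∈ Y)
    {i : I} (hi : i ∈ Y) (j : I) : j ∈ Y := by
  obtain ⟨p⟩ := hG.preconnected i j
  induction p with
  | nil => exact hi
  | cons h p ih => exact ih (hY _ hi _ h)

theorem IsVoltage.sum_flow_eq_zero (hW : IsVoltage G S0 l W) {i : I} (hi : i ∉ S0) (hil : i ≠ l) :
    ∑ j, flow G W i j = 0 := by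
  rw [← lapMatrix_mulVec_eq_sum_flow]; exact hW.2.2 i hi hil

/-- Minimum principle. -/
theorem IsVoltage.nonneg (hG : G.Connected) (hW : IsVoltage G S0 l W) (i : I) : 0 ≤ W i := by
  have : Nonempty I := ⟨i⟩
  obtain ⟨k, hk⟩ := Finite.exists_min W
  by_contra! hi
  have hk0 : W k < 0 := (hk i).trans_lt hi
  have : l ∈ {j | W j = W k} := by
    refine mem_of_adj_closed hG {j | W j = W k} ?_ (i := k) rfl l
    intro u hu v huv
    have hu : W u = W k := hu
    have huS : u ∉ S0 := fun h => by have := hW.1 u h; linarith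
    have hul : u ≠ l := by rintro rfl; have := hW.2.1; linarith
    have h0 := hW.sum_flow_eq_zero huS hul
    have hle : ∀ j ∈ univ, flow G W u j ≤ 0 := by
      intro j _
      simp only [flow]; split_ifs
      · linarith [hk j]
      · exact le_rfl
    have h1 := (sum_eq_zero_iff_of_nonpos hle).1 h0 v (mem_univ v)
    simp only [flow, if_pos huv] at h1
    change W v = W k
    linarith
  have h2 : W l = W k := this
  have := hW.2.1
  linarith

theorem IsVoltage.pos (hG : G.Connected) (hW : IsVoltage G S0 l W) (hl : l ∉ S0)
    (hleaf : ∀ s ∈ S0, G.degree s = 1) {i : I} (hi : i ∉ S0) : 0 < W i := by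
  refine lt_of_le_of_ne (hW.nonneg hG i) fun h0 => ?_
  -- Zeros off `S0` spread to all neighbours. A node of `S0` is a leaf, so it leads only back to the
  -- zero it was reached from.
  let Y : Set I := {j | (j ∉ S0 ∧ W j = 0) ∨ (j ∈ S0 ∧ ∃ k, G.Adj j k ∧ k ∉ S0 ∧ W k = 0)}
  have hlY : l ∈ Y := by
    refine mem_of_adj_closed hG Y ?_ (i := i) (Or.inl ⟨hi, h0.symm⟩) l
    rintro u (⟨huS, hu⟩ | ⟨huS, k, huk, hk⟩) v huv
    · have hul : u ≠ l := by rintro rfl; have := hW.2.1; linarith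
      have h1 := hW.sum_flow_eq_zero huS hul
      have hle : ∀ j ∈ univ, flow G W u j ≤ 0 := by
        intro j _
        simp only [flow]; split_ifs
        · linarith [hW.nonneg hG j]
        · exact le_rfl
      have h2 := (sum_eq_zero_iff_of_nonpos hle).1 h1 v (mem_univ v)
      simp only [flow, if_pos huv] at h2
      by_cases hv : v ∈ S0
      · exact Or.inr ⟨hv, u, huv.symm, huS, hu⟩
      · exact Or.inl ⟨hv, by linarith⟩
    · obtain ⟨w, hw⟩ := degree_eq_one_iff_existsUnique_adj.1 (hleaf u huS)
      have : v = k := (hw.2 v huv).trans (hw.2 k huk).symm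
      exact Or.inl (this ▸ hk)
  rcases hlY with ⟨_, h⟩ | ⟨h, _⟩
  · have := hW.2.1; linarith
  · exact hl h

theorem IsBridgeSide.sum_notMem_flow (hA : IsBridgeSide G A a l) {i : I} (hi : i ∈ A) :
    ∑ j ∈ Aᶜ, flow G W i j = if i = a then W a - W l else 0 := by
  split_ifs with h
  · subst h
    rw [sum_eq_single_of_mem l (by simpa using hA.notMem)]
    · simp [flow, hA.adj]
    · intro j hj hjl
      simp only [flow]
      exact if_neg fun h => hjl (hA.eq_of_adj _ hi j (by simpa using hj) h).2
  · refine sum_eq_zero fun j hj => ?_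
    simp only [flow]
    exact if_neg fun h' => h (hA.eq_of_adj _ hi j (by simpa using hj) h').1

theorem IsBridgeSide.compl (hA : IsBridgeSide G A a l) : IsBridgeSide G Aᶜ l a :=
  ⟨hA.adj.symm, by simpa using hA.notMem, by simpa using hA.mem, fun i hi j hj h =>
    (hA.eq_of_adj j (by simpa using hj) i (by simpa using hi) h.symm).symm⟩

/-- Current conservation inside one side of a bridge. -/
theorem IsBridgeSide.sum_mul_flow (hA : IsBridgeSide G A a l) (hW : IsVoltage G S0 l W)
    (g : I → ℝ) (hg : ∀ s ∈ S0, g s = 0) :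
    ∑ i ∈ A, ∑ j ∈ A, g i * flow G W i j = g a * (1 - W a) := by
  have h0 : ∑ i ∈ A, g i * ∑ j, flow G W i j = 0 := by
    refine sum_eq_zero fun i hi => ?_
    by_cases hs : i ∈ S0
    · rw [hg i hs, zero_mul]
    · rw [hW.sum_flow_eq_zero hs (fun h => hA.notMem (h ▸ hi)), mul_zero]
  have h1 : ∑ i ∈ A, g i * ∑ j, flow G W i j
      = ∑ i ∈ A, (∑ j ∈ A, g i * flow G W i j + if i = a then g a * (W a - W l) else 0) := by
    refine sum_congr rfl fun i hi => ?_
    rw [← sum_add_sum_compl A, hA.sum_notMem_flow hi, mul_add, mul_sum]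
    split_ifs with h
    · rw [h]
    · rw [mul_zero]
  rw [h1, sum_add_distrib, sum_ite_eq' A a, if_pos hA.mem, hW.2.1] at h0
  linarith

theorem IsBridgeSide.sum_flow_sq (hA : IsBridgeSide G A a l) (hW : IsVoltage G S0 l W) :
    ∑ i ∈ A, ∑ j ∈ A, flow G W i j ^ 2 = 2 * (W a * (1 - W a)) := by
  have h := hA.sum_mul_flow hW W hW.1
  have h2 := sum_symm_mul_flow_eq_zero (G := G) (W := W) A (fun i j => W i + W j)
    (fun i j => add_comm _ _)
  have : ∑ i ∈ A, ∑ j ∈ A, flow G W i j ^ 2 = 2 * (∑ i ∈ A, ∑ j ∈ A, W i * flow G W i j)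
      - ∑ i ∈ A, ∑ j ∈ A, (W i + W j) * flow G W i j := by
    rw [mul_sum, ← sum_sub_distrib]
    refine sum_congr rfl fun i _ => ?_
    rw [mul_sum, ← sum_sub_distrib]
    refine sum_congr rfl fun j _ => ?_
    simp only [flow]; split_ifs <;> ring
  rw [this, h, h2]; ring

/-- The voltage drops along a bridge leading to `S0`. -/
theorem IsBridgeSide.lt_one (hG : G.Connected) (hA : IsBridgeSide G A a l)
    (hW : IsVoltage G S0 l W) (ha : 0 ≤ W a) {s : I} (hsA : s ∈ A) (hs : s ∈ S0) : W a < 1 := by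
  rcases ha.eq_or_lt with h0 | hpos
  · rw [← h0]; exact one_pos
  have hsq := hA.sum_flow_sq hW
  have hnn : ∀ i ∈ A, 0 ≤ ∑ j ∈ A, flow G W i j ^ 2 := fun i _ => sum_nonneg fun j _ => sq_nonneg _
  have hle : 0 ≤ W a * (1 - W a) := by have := sum_nonneg hnn; linarith
  have hle1 : W a ≤ 1 := by nlinarith [nonneg_of_mul_nonneg_right hle hpos]
  refine lt_of_le_of_ne hle1 fun h1 => ?_
  rw [h1, sub_self, mul_zero, mul_zero] at hsq
  have hz : ∀ i ∈ A, ∀ j ∈ A, G.Adj i j → W i = W j := by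
    intro i hi j hj hij
    have h2 := (sum_eq_zero_iff_of_nonneg hnn).1 hsq i hi
    have h3 := (sum_eq_zero_iff_of_nonneg fun j _ => sq_nonneg _).1 h2 j hj
    simp only [flow, if_pos hij] at h3
    nlinarith
  have : s ∈ {i | i ∈ A → W i = 1} := by
    refine mem_of_adj_closed hG {i | i ∈ A → W i = 1} ?_ (i := l) (fun h => absurd h hA.notMem) s
    intro u hu v huv hv
    by_cases huA : u ∈ A
    · rw [← hz u huA v hv huv]; exact hu huA
    · rw [(hA.eq_of_adj v hv u huA huv.symm).1, h1]
  have h4 : W s = 1 := this hsA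
  rw [hW.1 s hs] at h4
  exact zero_ne_one h4

/-- The current through a level set inside one side of a bridge is at most the current through
the bridge. -/
theorem IsBridgeSide.sum_outflow_le (hA : IsBridgeSide G A a l) (hW : IsVoltage G S0 l W)
    (ha : W a ≤ 1) {t : ℝ} (ht : 0 < t) :
    ∑ i ∈ A with W i = t, outflow G W i ≤ 1 - W a := by
  -- Indicator of a superlevel set, zero on `S0` because `t` is positive. The weight g i (1 - g j)
  -- selects the edges leaving it, and all of these carry nonnegative current.
  let g : I → ℝ := fun i => if t ≤ W i then 1 else 0
  have h1 := hA.sum_mul_flow hW g (fun s hs => if_neg (by rw [hW.1 s hs]; linarith))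
  have h2 := sum_symm_mul_flow_eq_zero (G := G) (W := W) A (fun i j => g i * g j)
    (fun i j => mul_comm _ _)
  have h3 : g a * (1 - W a) ≤ 1 - W a := by
    simp only [g]; split_ifs <;> linarith
  have h4 : ∑ i ∈ A, ∑ j ∈ A, g i * (1 - g j) * flow G W i j = g a * (1 - W a) := by
    rw [← h1, ← sub_zero (∑ i ∈ A, ∑ j ∈ A, g i * flow G W i j), ← h2, ← sum_sub_distrib]
    refine sum_congr rfl fun i _ => ?_
    rw [← sum_sub_distrib]
    exact sum_congr rfl fun j _ => by ring
  have hterm : ∀ i j, 0 ≤ g i * (1 - g j) * flow G W i j := by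
    intro i j
    simp only [g, flow]
    split_ifs <;> simp
    linarith
  calc ∑ i ∈ A with W i = t, outflow G W i
      = ∑ i ∈ A with W i = t, ∑ j ∈ A, g i * (1 - g j) * flow G W i j := by
        refine sum_congr rfl fun i hi => ?_
        obtain ⟨hiA, hit⟩ := mem_filter.1 hi
        rw [outflow, ← sum_add_sum_compl A]
        have hz : ∑ j ∈ Aᶜ, max (flow G W i j) 0 = 0 := by
          refine sum_eq_zero fun j hj => ?_
          simp only [flow]
          split_ifs with hij
          · obtain ⟨rfl, rfl⟩ := hA.eq_of_adj i hiA j (by simpa using hj) hij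
            rw [hW.2.1]; exact max_eq_right (by linarith)
          · simp
        rw [hz, add_zero]
        refine sum_congr rfl fun j _ => ?_
        simp only [g, flow, hit, le_refl, if_true]
        split_ifs with hij hj
        · rw [max_eq_right (by linarith)]; ring
        · rw [max_eq_left (by linarith)]; ring
        · simp
        · simp
    _ ≤ ∑ i ∈ A, ∑ j ∈ A, g i * (1 - g j) * flow G W i j :=
        sum_le_sum_of_subset_of_nonneg (filter_subset _ _)
          fun i _ _ => sum_nonneg fun j _ => hterm i j
    _ ≤ 1 - W a := h4.trans_le h3

theorem outflow_nonneg (i : I) : 0 ≤ outflow G W i := sum_nonneg fun _ _ => le_max_right _ _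

theorem IsBridgeSide.outflow_le (hA : IsBridgeSide G A a l) (hW : IsVoltage G S0 l W)
    (ha : W a ≤ 1) {i : I} (hiA : i ∈ A) (hi : 0 < W i) : outflow G W i ≤ 1 - W a :=
  (single_le_sum (s := {k ∈ A | W k = W i}) (f := outflow G W) (fun _ _ => outflow_nonneg _)
    (mem_filter.2 ⟨hiA, rfl⟩)).trans (hA.sum_outflow_le hW ha hi)

/-! ### Squared currents at a node -/

theorem sum_abs_flow {i : I} (h : ∑ j, flow G W i j = 0) :
    ∑ j, |flow G W i j| = 2 * outflow G W i := by
  have : ∀ j, |flow G W i j| = 2 * max (flow G W i j) 0 - flow G W i j := by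
    intro j
    rcases le_total (flow G W i j) 0 with h | h
    · rw [abs_of_nonpos h, max_eq_right h]; ring
    · rw [abs_of_nonneg h, max_eq_left h]; ring
  simp only [this, sum_sub_distrib, h, outflow, mul_sum, sub_zero]

theorem abs_flow_le_outflow {i : I} (h : ∑ j, flow G W i j = 0) (j : I) :
    |flow G W i j| ≤ outflow G W i := by
  have h1 : ∀ k, max (flow G W i k) 0 - flow G W i k = max (-flow G W i k) 0 := by
    intro k
    rcases le_total (flow G W i k) 0 with h | h
    · rw [max_eq_right h, max_eq_left (by linarith)]; ring
    · rw [max_eq_left h, max_eq_right (by linarith)]; ring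
  have h2 : outflow G W i = ∑ k, max (-flow G W i k) 0 := by
    simp only [← h1, sum_sub_distrib, h, outflow, sub_zero]
  rw [abs_le']
  constructor
  · exact (le_max_left _ _).trans (single_le_sum (f := fun k => max (flow G W i k) 0)
      (fun _ _ => le_max_right _ _) (mem_univ j))
  · rw [h2]
    exact (le_max_left _ _).trans (single_le_sum (f := fun k => max (-flow G W i k) 0)
      (fun _ _ => le_max_right _ _) (mem_univ j))

/-- Written as an identity with explicit slack, so that both the bound and its equality case can be
read off. -/
theorem IsBridgeSide.sum_flow_sq_add_slack (hA : IsBridgeSide G A a l)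
    (hW : IsVoltage G S0 l W) {i : I} (hiA : i ∈ A) (hiS : i ∉ S0) :
    ∑ j, flow G W i j ^ 2 + ∑ j, |flow G W i j| * (1 - W a - |flow G W i j|)
      + 2 * (1 - W a) * (1 - W a - outflow G W i) = 2 * (1 - W a) ^ 2 := by
  have h0 := hW.sum_flow_eq_zero hiS (fun h => hA.notMem (h ▸ hiA))
  rw [← sum_add_distrib]
  have : ∀ j, flow G W i j ^ 2 + |flow G W i j| * (1 - W a - |flow G W i j|)
      = (1 - W a) * |flow G W i j| := by
    intro j; rw [← sq_abs]; ring
  simp only [this, ← mul_sum, sum_abs_flow h0]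
  ring

theorem IsBridgeSide.slack_nonneg (hA : IsBridgeSide G A a l) (hW : IsVoltage G S0 l W)
    (ha : W a ≤ 1) {i : I} (hiA : i ∈ A) (hiS : i ∉ S0) (hi : 0 < W i) (j : I) :
    0 ≤ |flow G W i j| * (1 - W a - |flow G W i j|) := by
  have h0 := hW.sum_flow_eq_zero hiS (fun h => hA.notMem (h ▸ hiA))
  exact mul_nonneg (abs_nonneg _) (by
    linarith [abs_flow_le_outflow h0 j, hA.outflow_le hW ha hiA hi])

theorem IsBridgeSide.sum_flow_sq_le (hA : IsBridgeSide G A a l) (hW : IsVoltage G S0 l W)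
    (ha : W a ≤ 1) {i : I} (hiA : i ∈ A) (hiS : i ∉ S0) (hi : 0 < W i) :
    ∑ j, flow G W i j ^ 2 ≤ 2 * (1 - W a) ^ 2 := by
  have h1 := hA.sum_flow_sq_add_slack hW hiA hiS
  have h2 := sum_nonneg fun j (_ : j ∈ univ) => hA.slack_nonneg hW ha hiA hiS hi j
  have h3 := hA.outflow_le hW ha hiA hi
  have h4 : 0 ≤ 2 * (1 - W a) * (1 - W a - outflow G W i) :=
    mul_nonneg (by linarith) (by linarith)
  linarith

/-- A side of a bridge that contains a node of degree at least three has a node at which the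
current splits. -/
theorem IsBridgeSide.exists_sum_flow_sq_lt (hA : IsBridgeSide G A a l) (hW : IsVoltage G S0 l W)
    (ha : W a < 1) (hpos : ∀ i ∉ S0, 0 < W i) {i : I} (hiA : i ∈ A) (hiS : i ∉ S0)
    (hdeg : 3 ≤ G.degree i) :
    ∃ k ∈ A, k ∉ S0 ∧ ∑ j, flow G W k j ^ 2 < 2 * (1 - W a) ^ 2 := by
  by_contra! hcon
  -- Equality forces full outflow at every node of `A` off `S0`, and each current there is 0 or ±(1
  -- - W a).
  have key : ∀ k ∈ A, k ∉ S0 → outflow G W k = 1 - W a ∧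
      ∀ j, |flow G W k j| * (1 - W a - |flow G W k j|) = 0 := by
    intro k hkA hkS
    have h1 := hA.sum_flow_sq_add_slack hW hkA hkS
    have h2 := hcon k hkA hkS
    have h3 := hA.slack_nonneg hW ha.le hkA hkS (hpos k hkS)
    have h4 := sum_nonneg fun j (_ : j ∈ univ) => h3 j
    have h5 := hA.outflow_le hW ha.le hkA (hpos k hkS)
    have h6 : 0 ≤ 2 * (1 - W a) * (1 - W a - outflow G W k) :=
      mul_nonneg (by linarith) (by linarith)
    have h7 : 2 * (1 - W a) * (1 - W a - outflow G W k) = 0 := by linarith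
    have h8 : ∑ j, |flow G W k j| * (1 - W a - |flow G W k j|) = 0 := by linarith
    refine ⟨?_, fun j => (sum_eq_zero_iff_of_nonneg fun j _ => h3 j).1 h8 j (mem_univ j)⟩
    rcases mul_eq_zero.1 h7 with h | h <;> linarith
  have hil : i ≠ l := fun h => hA.notMem (h ▸ hiA)
  obtain ⟨hout, hfl⟩ := key i hiA hiS
  -- A currentless edge would put two nodes of full outflow on one level. Without one, at least
  -- three edges at `i` carry full current, but the absolute currents total only 2(1 - W a).
  by_cases hz : ∃ j, G.Adj i j ∧ W i = W j
  · obtain ⟨j, hij, hWj⟩ := hz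
    have hjA : j ∈ A := by
      by_contra hj
      obtain ⟨rfl, rfl⟩ := hA.eq_of_adj i hiA j hj hij
      rw [hWj, hW.2.1] at ha
      exact lt_irrefl _ ha
    have hjS : j ∉ S0 := fun h => by
      have := hpos i hiS
      rw [hWj, hW.1 j h] at this
      exact lt_irrefl _ this
    have h1 := hA.sum_outflow_le hW ha.le (hpos i hiS)
    have h2 : ∑ k ∈ {i, j}, outflow G W k ≤ ∑ k ∈ A with W k = W i, outflow G W k := by
      refine sum_le_sum_of_subset_of_nonneg ?_ fun _ _ _ => outflow_nonneg _
      intro k hk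
      rcases mem_insert.1 hk with rfl | hk
      · simp [hiA]
      · rw [mem_singleton.1 hk]; simp [hjA, hWj]
    rw [sum_pair hij.ne, hout, (key j hjA hjS).1] at h2
    linarith
  · push Not at hz
    have h1 : ∀ j ∈ G.neighborFinset i, 1 - W a ≤ |flow G W i j| := by
      intro j hj
      rw [mem_neighborFinset] at hj
      rcases mul_eq_zero.1 (hfl j) with h | h
      · rw [abs_eq_zero, flow, if_pos hj] at h
        exact absurd (sub_eq_zero.1 h) (hz j hj)
      · linarith
    have h2 := sum_le_sum h1
    rw [sum_const, card_neighborFinset_eq_degree, nsmul_eq_mul] at h2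
    have h3 : ∑ j ∈ G.neighborFinset i, |flow G W i j| ≤ ∑ j, |flow G W i j| :=
      sum_le_sum_of_subset_of_nonneg (subset_univ _) fun _ _ _ => abs_nonneg _
    rw [sum_abs_flow (hW.sum_flow_eq_zero hiS hil), hout] at h3
    have h4 : (3 : ℝ) ≤ G.degree i := by exact_mod_cast hdeg
    nlinarith

/-- Summation by parts with weight W², since W i (W i - W j) = W i² - W i W j; the last term is the
bridge edge at `a`. -/
theorem IsBridgeSide.sum_mul_sum_flow_sq (hA : IsBridgeSide G A a l) (hW : IsVoltage G S0 l W) :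
    ∑ i ∈ A, W i * ∑ j, flow G W i j ^ 2 = W a ^ 2 * (1 - W a) + W a * (1 - W a) ^ 2 := by
  have h1 := hA.sum_mul_flow hW (fun i => W i ^ 2) (fun s hs => by simp [hW.1 s hs])
  have h2 := sum_symm_mul_flow_eq_zero (G := G) (W := W) A (fun i j => W i * W j)
    (fun i j => mul_comm _ _)
  have h3 : ∑ i ∈ A, ∑ j ∈ A, W i * flow G W i j ^ 2 = W a ^ 2 * (1 - W a) := by
    rw [← h1, ← sub_zero (∑ i ∈ A, ∑ j ∈ A, W i ^ 2 * flow G W i j), ← h2, ← sum_sub_distrib]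
    refine sum_congr rfl fun i _ => ?_
    rw [← sum_sub_distrib]
    refine sum_congr rfl fun j _ => ?_
    simp only [flow]; split_ifs <;> ring
  have h4 : ∀ i ∈ A, ∑ j ∈ Aᶜ, flow G W i j ^ 2 = if i = a then (1 - W a) ^ 2 else 0 := by
    intro i hi
    split_ifs with h
    · subst h
      rw [sum_eq_single_of_mem l (by simpa using hA.notMem)]
      · simp only [flow, if_pos hA.adj, hW.2.1]; ring
      · intro j hj hjl
        rw [flow, if_neg fun h => hjl (hA.eq_of_adj _ hi j (by simpa using hj) h).2]; ring
    · refine sum_eq_zero fun j hj => ?_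
      rw [flow, if_neg fun h' => h (hA.eq_of_adj _ hi j (by simpa using hj) h').1]; ring
  have h5 : ∑ i ∈ A, W i * ∑ j, flow G W i j ^ 2
      = ∑ i ∈ A, (∑ j ∈ A, W i * flow G W i j ^ 2
        + if i = a then W a * (1 - W a) ^ 2 else 0) := by
    refine sum_congr rfl fun i hi => ?_
    rw [← sum_add_sum_compl A, h4 i hi, mul_add, mul_sum]
    split_ifs with h
    · rw [h]
    · rw [mul_zero]
  rw [h5, sum_add_distrib, h3, sum_ite_eq' A a, if_pos hA.mem]

theorem IsBridgeSide.le_two_mul_sum (hA : IsBridgeSide G A a l) (hW : IsVoltage G S0 l W)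
    (ha : W a < 1) (hpos : ∀ i ∉ S0, 0 < W i) :
    W a ≤ 2 * ((1 - W a) * ∑ i ∈ A, W i) := by
  have h1 := hA.sum_mul_sum_flow_sq hW
  have h2 : ∑ i ∈ A, W i * ∑ j, flow G W i j ^ 2 ≤ ∑ i ∈ A, W i * (2 * (1 - W a) ^ 2) := by
    refine sum_le_sum fun i hi => ?_
    by_cases hs : i ∈ S0
    · simp [hW.1 i hs]
    · exact mul_le_mul_of_nonneg_left (hA.sum_flow_sq_le hW ha.le hi hs (hpos i hs)) (hpos i hs).le
  rw [← sum_mul, h1] at h2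
  have h7 : (1 - W a) * W a ≤ (1 - W a) * (2 * ((1 - W a) * ∑ i ∈ A, W i)) := by
    linarith
  exact le_of_mul_le_mul_left h7 (by linarith)

theorem IsBridgeSide.lt_two_mul_sum (hA : IsBridgeSide G A a l) (hW : IsVoltage G S0 l W)
    (ha : W a < 1) (hpos : ∀ i ∉ S0, 0 < W i) {k : I} (hkA : k ∈ A) (hkS : k ∉ S0)
    (hdeg : 3 ≤ G.degree k) :
    W a < 2 * ((1 - W a) * ∑ i ∈ A, W i) := by
  have h1 := hA.sum_mul_sum_flow_sq hW
  obtain ⟨m, hmA, hmS, hm⟩ := hA.exists_sum_flow_sq_lt hW ha hpos hkA hkS hdeg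
  have h2 : ∑ i ∈ A, W i * ∑ j, flow G W i j ^ 2 < ∑ i ∈ A, W i * (2 * (1 - W a) ^ 2) := by
    refine sum_lt_sum (fun i hi => ?_) ⟨m, hmA, mul_lt_mul_of_pos_left hm (hpos m hmS)⟩
    by_cases hs : i ∈ S0
    · simp [hW.1 i hs]
    · exact mul_le_mul_of_nonneg_left (hA.sum_flow_sq_le hW ha.le hi hs (hpos i hs)) (hpos i hs).le
  rw [← sum_mul, h1] at h2
  have h7 : (1 - W a) * W a < (1 - W a) * (2 * ((1 - W a) * ∑ i ∈ A, W i)) := by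
    linarith
  exact lt_of_mul_lt_mul_left h7 (by linarith)

end Flow

/-! ### Moving the source across a bridge -/

section Transfer

variable {G : SimpleGraph I} [DecidableRel G.Adj] {S0 A : Finset I} {a l : I} {W : I → ℝ}

theorem hic_eq_sum_sub_one (hG : G.Connected) (hl : l ∉ S0) :
    hic G S0 l = ∑ i, voltage G S0 l i - 1 := by
  rw [hic, ← sum_erase_add univ _ (mem_univ l), (isVoltage_voltage hG hl).2.1]
  ring

/-- Moving the source across a bridge rescales the voltage on both sides of the bridge. -/
theorem IsBridgeSide.sum_voltage (hG : G.Connected) (hA : IsBridgeSide G A a l) (hl : l ∉ S0)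
    (ha : a ∉ S0) (hWa : W a ≠ 0) (hW : IsVoltage G S0 l W)
    {D : ℝ} (hD : ∑ j, flow G W l j + W a = D) (hD0 : D ≠ 0) :
    ∑ i, voltage G S0 a i = (∑ i ∈ A, W i) / W a + (∑ i ∈ Aᶜ, W i) / D := by
  -- `D` is 1 plus the current leaving `l` away from `A`, the scaling that restores Kirchhoff's law
  -- at `l`.
  let V : I → ℝ := fun i => if i ∈ A then W i / W a else W i / D
  have hVA : ∀ i ∈ A, V i = W i / W a := fun i hi => if_pos hi
  have hVc : ∀ i ∉ A, V i = W i / D := fun i hi => if_neg hi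
  have hV : IsVoltage G S0 a V := by
    refine ⟨fun s hs => ?_, ?_, fun i hi hia => ?_⟩
    · simp only [V, hW.1 s hs, zero_div, ite_self]
    · rw [hVA a hA.mem, div_self hWa]
    · rw [lapMatrix_mulVec_eq_sum_flow]
      by_cases hiA : i ∈ A
      · have h1 : ∀ j, flow G V i j = flow G W i j / W a := by
          intro j
          simp only [flow]
          split_ifs with hij
          · have hj : j ∈ A := by
              by_contra hj
              exact hia (hA.eq_of_adj i hiA j hj hij).1
            rw [hVA i hiA, hVA j hj, sub_div]
          · rw [zero_div]
        simp only [h1]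
        rw [← sum_div, hW.sum_flow_eq_zero hi fun h => hA.notMem (h ▸ hiA), zero_div]
      · by_cases hil : i = l
        · subst hil
          have h1 : ∑ j ∈ Aᶜ, flow G V i j = (∑ j ∈ Aᶜ, flow G W i j) / D := by
            rw [sum_div]
            refine sum_congr rfl fun j hj => ?_
            simp only [flow]
            split_ifs
            · rw [hVc i hiA, hVc j (by simpa using hj), sub_div]
            · rw [zero_div]
          have h2 := hA.compl.sum_notMem_flow (W := V) (i := i) (by simpa using hiA)
          have h3 := hA.compl.sum_notMem_flow (W := W) (i := i) (by simpa using hiA)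
          rw [compl_compl, if_pos rfl] at h2 h3
          have h4 := sum_add_sum_compl A (flow G W i)
          rw [← sum_add_sum_compl A, h1, h2, hVc i hiA, hVA a hA.mem, div_self hWa]
          rw [hW.2.1] at h3 ⊢
          have h5 : ∑ j ∈ Aᶜ, flow G W i j = D - 1 := by linarith
          rw [h5]
          field_simp
          ring
        · have h1 : ∀ j, flow G V i j = flow G W i j / D := by
            intro j
            simp only [flow]
            split_ifs with hij
            · have hj : j ∉ A := fun hj => hil (hA.eq_of_adj j hj i hiA hij.symm).2
              rw [hVc i hiA, hVc j hj, sub_div]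
            · rw [zero_div]
          simp only [h1]
          rw [← sum_div, hW.sum_flow_eq_zero hi hil, zero_div]
  rw [(existsUnique_isVoltage hG ha).unique (isVoltage_voltage hG ha) hV,
    ← sum_add_sum_compl A, sum_div, sum_div]
  congr 1
  · exact sum_congr rfl fun i hi => hVA i hi
  · exact sum_congr rfl fun i hi => hVc i (by simpa using hi)

theorem IsBridgeSide.eq_of_degree_eq_one (hG : G.Connected) (hA : IsBridgeSide G A a l)
    (ha : G.degree a = 1) {i : I} (hi : i ∈ A) : i = a := by
  have : i ∈ {i | i ∈ A → i = a} := by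
    refine mem_of_adj_closed hG {i | i ∈ A → i = a} ?_ (i := l) (fun h => absurd h hA.notMem) i
    intro u hu v huv hv
    by_cases huA : u ∈ A
    · obtain rfl := hu huA
      obtain ⟨w, hw⟩ := degree_eq_one_iff_existsUnique_adj.1 ha
      have : v = l := (hw.2 v huv).trans (hw.2 l hA.adj).symm
      exact absurd (this ▸ hv) hA.notMem
    · exact (hA.eq_of_adj v hv u huA huv.symm).1
  exact this hi

/-- If all of `S0` lies beyond the bridge `a l`, then `a` is more central than `l`. -/
theorem IsBridgeSide.hic_lt (hG : G.Connected) (hA : IsBridgeSide G A a l)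
    (hleaf : ∀ s ∈ S0, G.degree s = 1) (hS : S0 ⊆ A) (hS0 : S0.Nonempty) (ha : a ∉ S0) :
    hic G S0 l < hic G S0 a := by
  have hl : l ∉ S0 := fun h => hA.notMem (hS h)
  have hW := isVoltage_voltage hG hl
  set W := voltage G S0 l with hWdef
  have hpos := fun i => hW.pos (i := i) hG hl hleaf
  obtain ⟨s, hs⟩ := hS0
  have hlt := hA.lt_one hG hW (hpos a ha).le (hS hs) hs
  -- Beyond the bridge only `l` is a source, so all its current crosses the bridge; hence D = 1.
  have h1 : ∑ i ∈ Aᶜ, ∑ j ∈ Aᶜ, flow G W i j = 0 := by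
    simpa using sum_symm_mul_flow_eq_zero (G := G) (W := W) Aᶜ (fun _ _ => 1) fun _ _ => rfl
  have h2 : ∑ i ∈ Aᶜ, ∑ j, flow G W i j = ∑ j, flow G W l j := by
    refine sum_eq_single_of_mem l (by simpa using hA.notMem) fun i hi hil => ?_
    exact hW.sum_flow_eq_zero (fun h => (mem_compl.1 hi) (hS h)) hil
  have h3 : ∑ i ∈ Aᶜ, ∑ j, flow G W i j = ∑ i ∈ Aᶜ, if i = l then W l - W a else 0 := by
    refine Eq.trans ?_ ((congrArg (_ + ·) h1).trans (add_zero _))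
    rw [← sum_add_distrib]
    refine sum_congr rfl fun i hi => ?_
    rw [← sum_add_sum_compl A, ← hA.compl.sum_notMem_flow hi, compl_compl]
  rw [h2, sum_ite_eq' Aᶜ l, if_pos hA.compl.mem, hW.2.1] at h3
  have h4 := hA.sum_voltage hG hl ha (hpos a ha).ne' hW (D := 1) (by rw [h3]; ring) one_ne_zero
  rw [hic_eq_sum_sub_one hG hl, hic_eq_sum_sub_one hG ha, h4, ← sum_add_sum_compl A, div_one]
  have h5 : 0 < ∑ i ∈ A, W i :=
    (hpos a ha).trans_le (single_le_sum (fun i _ => hW.nonneg hG i) hA.mem)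
  have h6 : ∑ i ∈ A, W i < (∑ i ∈ A, W i) / W a := by
    rw [lt_div_iff₀ (hpos a ha)]; nlinarith
  linarith

theorem bridge_identity {x P : ℝ} (hx : 0 < x) (hx1 : x < 1) :
    P / x + (P + 1) / (2 - x) - (2 * P + 1)
      = (1 - x) / (x * (2 - x)) * (2 * ((1 - x) * P) - x) := by
  have : 2 - x ≠ 0 := by linarith
  field_simp
  ring

/-- A node `l` of degree two that separates `S0` is less central than one of its neighbours,
provided that one of its two sides contains a node of degree at least three. -/
theorem IsBridgeSide.exists_hic_lt {B : Finset I} {b : I} (hG : G.Connected)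
    (hA : IsBridgeSide G A a l) (hB : IsBridgeSide G B b l) (hl : l ∉ S0)
    (hleaf : ∀ s ∈ S0, G.degree s = 1) (hab : a ≠ b) (hnb : G.neighborFinset l = {a, b})
    (hAc : Aᶜ = insert l B) (hBc : Bᶜ = insert l A)
    {s t k : I} (hs : s ∈ S0) (ht : t ∈ S0) (hsA : s ∈ A) (htB : t ∈ B)
    (hkA : k ∈ A) (hk : 3 ≤ G.degree k) : ∃ m ∉ S0, hic G S0 l < hic G S0 m := by
  have hW := isVoltage_voltage hG hl
  set W := voltage G S0 l with hWdef
  have hpos := fun i => hW.pos (i := i) hG hl hleaf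
  have ha : a ∉ S0 := fun h => by
    rw [hA.eq_of_degree_eq_one hG (hleaf a h) hkA, hleaf a h] at hk
    omega
  have hkS : k ∉ S0 := fun h => by rw [hleaf k h] at hk; omega
  have hxpos := hpos a ha
  have hx1 := hA.lt_one hG hW hxpos.le hsA hs
  have hy1 := hB.lt_one hG hW (hW.nonneg hG b) htB ht
  have hP := hA.lt_two_mul_sum hW hx1 hpos hkA hkS hk
  have hfl : ∑ j, flow G W l j = (1 - W a) + (1 - W b) := by
    have : ∀ j, flow G W l j = if j ∈ G.neighborFinset l then 1 - W j else 0 := by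
      intro j; simp only [flow, mem_neighborFinset, hW.2.1]
    simp only [this]
    rw [← sum_filter, filter_mem_eq_inter, univ_inter, hnb, sum_pair hab]
  have hAs : ∑ i ∈ Aᶜ, W i = 1 + ∑ i ∈ B, W i := by
    rw [hAc, sum_insert hB.notMem, hW.2.1]
  have hBs : ∑ i ∈ Bᶜ, W i = 1 + ∑ i ∈ A, W i := by
    rw [hBc, sum_insert hA.notMem, hW.2.1]
  have hla := hA.sum_voltage hG hl ha hxpos.ne' hW (D := 2 - W b) (by rw [hfl]; ring)
    (by linarith)
  have htot := sum_add_sum_compl A W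
  rw [hAs] at hla htot
  rw [hic_eq_sum_sub_one hG hl]
  set P := ∑ i ∈ A, W i
  set Q := ∑ i ∈ B, W i
  -- If `b` is in `S0`, the source cannot move there; but then W b = Q = 0, and `a` alone wins.
  by_cases hb : b ∈ S0
  · refine ⟨a, ha, ?_⟩
    rw [hic_eq_sum_sub_one hG ha, hla, ← hWdef, ← htot]
    have hQ : Q = 0 := sum_eq_zero fun i hi => by
      rw [hB.eq_of_degree_eq_one hG (hleaf b hb) hi, hW.1 b hb]
    rw [hQ, hW.1 b hb]
    have : P + 1 / 2 < P / W a := by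
      rw [lt_div_iff₀ hxpos]; linarith
    linarith
  · have hypos := hpos b hb
    have hQ := hB.le_two_mul_sum hW hy1 hpos
    have hlb := hB.sum_voltage hG hl hb hypos.ne' hW (D := 2 - W a) (by rw [hfl]; ring)
      (by linarith)
    rw [hBs] at hlb
    have e1 := bridge_identity (P := P) hxpos hx1
    have e2 := bridge_identity (P := Q) hypos hy1
    have p1 : 0 < (1 - W a) / (W a * (2 - W a)) * (2 * ((1 - W a) * P) - W a) :=
      mul_pos (div_pos (by linarith) (mul_pos hxpos (by linarith))) (by linarith)
    -- The degree condition is known only on side `A`, so this bound is not strict.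
    have p2 : 0 ≤ (1 - W b) / (W b * (2 - W b)) * (2 * ((1 - W b) * Q) - W b) :=
      mul_nonneg (div_pos (by linarith) (mul_pos hypos (by linarith))).le (by linarith)
    by_contra! hcon
    have c1 := hcon a ha
    have c2 := hcon b hb
    rw [hic_eq_sum_sub_one hG ha, hla, ← hWdef, ← htot] at c1
    rw [hic_eq_sum_sub_one hG hb, hlb, ← hWdef, ← htot] at c2
    rw [add_comm 1 Q] at c1
    rw [add_comm 1 P] at c2
    linarith

end Transfer

/-! ### The sides of a node in a tree -/

section Tree

variable {T : SimpleGraph I} {S0 : Finset I} {a b l : I}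

open Classical in
/-- The vertices that can be reached from `a` without passing through `l`. -/
noncomputable def side (T : SimpleGraph I) (l a : I) : Finset I :=
  univ.filter fun v => ∃ p : T.Walk a v, l ∉ p.support

theorem mem_side {v : I} : v ∈ side T l a ↔ ∃ p : T.Walk a v, l ∉ p.support := by
  simp [side]

theorem support_subset_of_isPath (hT : T.IsAcyclic) {u v : I} {p : T.Walk u v} (hp : p.IsPath)
    (q : T.Walk u v) : p.support ⊆ q.support := by
  have h := (hT.subsingleton_path u v).elim ⟨p, hp⟩ ⟨q.bypass, q.bypass_isPath⟩
  have h' : p = q.bypass := congrArg Subtype.val h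
  rw [h']
  exact q.support_bypass_subset_support

theorem eq_of_mem_side (hT : T.IsAcyclic) {v : I} (hal : T.Adj a l) (hv : v ∈ side T l a)
    (hlv : T.Adj l v) : v = a := by
  by_contra hva
  obtain ⟨q, hq⟩ := mem_side.1 hv
  have hp : (Walk.cons hal (Walk.cons hlv Walk.nil)).IsPath := by
    simp [Walk.cons_isPath_iff, hal.ne, hlv.ne, Ne.symm hva]
  exact hq (support_subset_of_isPath hT hp q (by simp))

theorem mem_side_of_adj {v w : I} (hv : v ∈ side T l a) (hvw : T.Adj v w) (hw : w ≠ l) :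
    w ∈ side T l a := by
  obtain ⟨q, hq⟩ := mem_side.1 hv
  exact mem_side.2 ⟨q.concat hvw, by simp [Walk.support_concat, hq, hw.symm]⟩

theorem isBridgeSide_side (hT : T.IsAcyclic) (hal : T.Adj a l) :
    IsBridgeSide T (side T l a) a l := by
  refine ⟨hal, mem_side.2 ⟨Walk.nil, by simpa using hal.ne'⟩, fun h => ?_, fun i hi j hj hij => ?_⟩
  · obtain ⟨q, hq⟩ := mem_side.1 h
    exact hq q.end_mem_support
  · have hjl : j = l := by
      by_contra hjl
      exact hj (mem_side_of_adj hi hij hjl)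
    subst hjl
    exact ⟨eq_of_mem_side hT hal hi hij.symm, rfl⟩

theorem exists_mem_side (hT : T.Connected) {v : I} (hv : v ≠ l) :
    ∃ a, T.Adj l a ∧ v ∈ side T l a := by
  obtain ⟨p, hp⟩ := (hT.preconnected l v).exists_isPath
  cases p with
  | nil => exact absurd rfl hv
  | cons h q => exact ⟨_, h, mem_side.2 ⟨q, ((Walk.cons_isPath_iff _ _).1 hp).2⟩⟩

theorem eq_of_mem_side_of_mem_side (hT : T.IsAcyclic) {v : I} (hal : T.Adj a l)
    (hbl : T.Adj b l) (ha : v ∈ side T l a) (hb : v ∈ side T l b) : b = a := by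
  obtain ⟨p, hp⟩ := mem_side.1 ha
  obtain ⟨q, hq⟩ := mem_side.1 hb
  refine eq_of_mem_side hT hal (mem_side.2 ⟨p.append q.reverse, ?_⟩) hbl.symm
  simp [Walk.mem_support_append_iff, hp, hq]

variable [DecidableRel T.Adj]

/-- Paths within `S0` avoid `l`, so `S0` fits in one side. The neighbour `a` is off `S0`, since a
leaf would be its whole side, too small for two nodes. -/
theorem exists_hic_lt_of_notMem_pathNodes (hT : T.IsTree) (hleaf : ∀ s ∈ S0, T.degree s = 1)
    (hcard : 2 ≤ S0.card) (hl : l ∉ S0) (hlK : l ∉ pathNodes T S0) :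
    ∃ m ∉ S0, hic T S0 l < hic T S0 m := by
  obtain ⟨s, hs, t, ht, hst⟩ := one_lt_card.1 hcard
  obtain ⟨a, hla, hsa⟩ := exists_mem_side hT.connected (l := l) (v := s) fun h => hl (h ▸ hs)
  have hA := isBridgeSide_side hT.isAcyclic hla.symm
  have hS : S0 ⊆ side T l a := by
    intro u hu
    obtain ⟨p, hp⟩ := (hT.connected.preconnected s u).exists_isPath
    obtain ⟨q, hq⟩ := mem_side.1 hsa
    have hlp : l ∉ p.support := fun h => hlK ⟨s, hs, u, hu, p, hp, h⟩
    exact mem_side.2 ⟨q.append p, by simp [Walk.mem_support_append_iff, hlp, hq]⟩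
  have ha : a ∉ S0 := fun h => hst <|
    (hA.eq_of_degree_eq_one hT.connected (hleaf a h) (hS hs)).trans
      (hA.eq_of_degree_eq_one hT.connected (hleaf a h) (hS ht)).symm
  exact ⟨a, ha, hA.hic_lt hT.connected hleaf hS ⟨s, hs⟩ ha⟩

/-- The two ends of the path lie in different sides of `l`, so `l` has exactly two neighbours. The
node `k` may be anywhere in the tree: only its side matters. -/
theorem exists_hic_lt_of_degree_lt_three (hT : T.IsTree) (hleaf : ∀ s ∈ S0, T.degree s = 1)
    (hl : l ∉ S0) (hlK : l ∈ pathNodes T S0) (hdeg : T.degree l < 3)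
    {k : I} (hk : 3 ≤ T.degree k) : ∃ m ∉ S0, hic T S0 l < hic T S0 m := by
  obtain ⟨s, hs, t, ht, p, hp, hlp⟩ := hlK
  obtain ⟨a, hla, hsa⟩ := exists_mem_side hT.connected (l := l) (v := s) fun h => hl (h ▸ hs)
  obtain ⟨b, hlb, htb⟩ := exists_mem_side hT.connected (l := l) (v := t) fun h => hl (h ▸ ht)
  have hab : a ≠ b := by
    rintro rfl
    obtain ⟨q, hq⟩ := mem_side.1 hsa
    obtain ⟨r, hr⟩ := mem_side.1 htb
    have := support_subset_of_isPath hT.isAcyclic hp (q.reverse.append r) hlp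
    simp [Walk.mem_support_append_iff, hq, hr] at this
  have hnb : T.neighborFinset l = {a, b} := by
    refine (eq_of_subset_of_card_le ?_ ?_).symm
    · intro x hx
      rw [mem_neighborFinset]
      rcases mem_insert.1 hx with rfl | hx
      · exact hla
      · rwa [mem_singleton.1 hx]
    · rw [card_neighborFinset_eq_degree, card_pair hab]; omega
  have hcover : ∀ v, v ≠ l → v ∈ side T l a ∨ v ∈ side T l b := by
    intro v hv
    obtain ⟨c, hlc, hvc⟩ := exists_mem_side hT.connected hv
    have : c ∈ T.neighborFinset l := by rwa [mem_neighborFinset]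
    rw [hnb, mem_insert, mem_singleton] at this
    rcases this with rfl | rfl
    · exact Or.inl hvc
    · exact Or.inr hvc
  have hA := isBridgeSide_side hT.isAcyclic hla.symm
  have hB := isBridgeSide_side hT.isAcyclic hlb.symm
  have hdisj : ∀ v, v ∈ side T l a → v ∉ side T l b := fun v hva hvb =>
    hab (eq_of_mem_side_of_mem_side hT.isAcyclic hla.symm hlb.symm hva hvb).symm
  have hAc : (side T l a)ᶜ = insert l (side T l b) := by
    ext v
    rw [mem_compl, mem_insert]
    constructor
    · intro hv
      by_cases hvl : v = l
      · exact Or.inl hvl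
      · exact Or.inr ((hcover v hvl).resolve_left hv)
    · rintro (rfl | hv)
      · exact hA.notMem
      · exact fun h => hdisj v h hv
  have hBc : (side T l b)ᶜ = insert l (side T l a) := by
    ext v
    rw [mem_compl, mem_insert]
    constructor
    · intro hv
      by_cases hvl : v = l
      · exact Or.inl hvl
      · exact Or.inr ((hcover v hvl).resolve_right hv)
    · rintro (rfl | hv)
      · exact hB.notMem
      · exact hdisj v hv
  rcases hcover k (by rintro rfl; omega) with hkA | hkB
  · exact hA.exists_hic_lt hT.connected hB hl hleaf hab hnb hAc hBc hs ht hsa htb hkA hk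
  · exact hB.exists_hic_lt hT.connected hA hl hleaf hab.symm (by rw [hnb, pair_comm]) hBc hAc
      ht hs htb hsa hkB hk

end Tree

/-! ### Comparison of maximizers -/

theorem argmaxOn_eq_of_exists_lt {α : Type*} [Finite α] {f : α → ℝ} {A B : Set α} (hBA : B ⊆ A)
    (h : ∀ l ∈ A, l ∉ B → ∃ m ∈ A, f l < f m) : argmaxOn f A = argmaxOn f B := by
  have hmem : ∀ l ∈ A, (∀ m ∈ A, f m ≤ f l) → l ∈ B := by
    intro l hl hmax
    by_contra hlB
    obtain ⟨m, hm, hlt⟩ := h l hl hlB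
    exact (hmax m hm).not_gt hlt
  ext l
  constructor
  · rintro ⟨hl, hmax⟩
    exact ⟨hmem l hl hmax, fun m hm => hmax m (hBA hm)⟩
  · rintro ⟨hl, hmax⟩
    refine ⟨hBA hl, fun m hm => ?_⟩
    obtain ⟨M, hMA, hM⟩ := Set.exists_max_image A f A.toFinite ⟨l, hBA hl⟩
    exact (hM m hm).trans (hmax M (hmem M hMA hM))

end OSAP

theorem mainTheorem1 {I : Type*} [Fintype I] [DecidableEq I] (T : SimpleGraph I)
    [DecidableRel T.Adj] (hT : T.IsTree) (S0 : Finset I)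
    (hleaf : ∀ s ∈ S0, T.degree s = 1) (hcard : 2 ≤ S0.card) :
    OSAP.argmaxOn (OSAP.hic T S0) {l | l ∉ S0} =
        OSAP.argmaxOn (OSAP.hic T S0) {l | l ∈ OSAP.pathNodes T S0 ∧ l ∉ S0} ∧
      ((OSAP.branchNodes T S0).Nonempty →
        OSAP.argmaxOn (OSAP.hic T S0) {l | l ∉ S0} =
          OSAP.argmaxOn (OSAP.hic T S0) (OSAP.branchNodes T S0)) := by
  have hoff := fun l => OSAP.exists_hic_lt_of_notMem_pathNodes (l := l) hT hleaf hcard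
  constructor
  · refine OSAP.argmaxOn_eq_of_exists_lt (fun l hl => hl.2) fun l hl hlK => ?_
    exact hoff l hl fun h => hlK ⟨h, hl⟩
  · rintro ⟨k, _, hk⟩
    refine OSAP.argmaxOn_eq_of_exists_lt (fun l hl hlS => ?_) fun l hl hlK => ?_
    · have := hl.2
      rw [hleaf l hlS] at this
      omega
    · by_cases h : l ∈ OSAP.pathNodes T S0
      · exact OSAP.exists_hic_lt_of_degree_lt_three hT hleaf hl h
          (not_le.1 fun h3 => hlK ⟨h, h3⟩) hk
      · exact hoff l hl h
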